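/- Let $R$ be a commutative unital ring, $A$ and $B$ unital $R$-algebras, $M$ an $(A,B)$-bimodule and $N$ a $(B,A)$-bimodule (unital, with compatible $R$-actions), at least one of $M,N$ nonzero, and let $\Phi: M\otimes_B N\to A$, $\Psi: N\otimes_A M\to B$ be bimodule homomorphisms, written $\Phi(m\otimes n)=mn$ and $\Psi(n\otimes m)=nm$, with $(mn)m'=m(nm')$ and $(nm)n'=n(mn')$ for all $m,m'\in M$, $n,n'\in N$. Let $$\mathcal G=\begin{pmatrix}A&M\\N&B\end{pmatrix}$$ be the corresponding generalized matrix algebra, with the usual matrix operations, and let $\pi_A:\mathcal G\to A$, $\pi_B:\mathcal G\to B$ be the projections onto the diagonal entries. Write $Z(\cdot)$ for the center of an algebra and $[x,y]=xy-yx$. For an $R$-algebra $S$, a sequence $(D_k)_{k\ge 0}$ of $R$-linear maps $S\to S$ with $D_0=\mathrm{id}$ is a higher derivation if $D_k(xy)=\sum_{i+j=k}D_i(x)D_j(y)$ for all $x,y\in S$, $k\ge 0$. A sequence $(L_k)_{k\ge 0}$ of $R$-linear maps $S\to S$ with $L_0=\mathrm{id}$ is a Lie higher derivation if $L_k([x,y])=\sum_{i+j=k}[L_i(x),L_j(y)]$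 for all $x,y\in S$, $k\ge 0$. It is proper if there are a higher derivation $(D_k)_{k\ge 0}$ and $R$-linear maps $\tau_k:S\to Z(S)$, $k\ge1$, with $\tau_k([x,y])=0$ for all $x,y\in S$, such that $L_k=D_k+\tau_k$ for all $k\ge 1$. The algebra $S$ has the LHD property if every Lie higher derivation on $S$ is proper. Assume that $M$ and $N$ are $2$-torsion free ($2x=0$ implies $x=0$), and that $\mathcal G$ is weakly faithful: for $a\in A$, $aM=0=Na$ implies $a=0$, and for $b\in B$, $Mb=0=bN$ implies $b=0$. Suppose that (i) $\pi_A(Z(\mathcal G))=Z(A)$ and $\pi_B(Z(\mathcal G))=Z(B)$, and (ii) $A$ and $B$ are domains (i.e. have no zero divisors; they need not be commutative). Then $\mathcal G$ has the LHD property. -/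

import Mathlib

open MulOpposite Finset

/-- A sequence of `R`-linear maps `D k : S → S` with `D 0 = id` and
`D k (x y) = ∑_{i+j=k} D i x * D j y`. -/
structure IsHigherDerivation (R : Type*) {S : Type*} [CommRing R] [Ring S] [Algebra R S]
    (D : ℕ → S →ₗ[R] S) : Prop where
  map_zero : D 0 = LinearMap.id
  map_mul : ∀ (k : ℕ) (x y : S),
    D k (x * y) = ∑ p ∈ antidiagonal k, D p.1 x * D p.2 y

/-- A sequence of `R`-linear maps `L k : S → S` with `L 0 = id` and
`L k [x, y] = ∑_{i+j=k} [L i x, L j y]`, where `[x, y] = x y - y x`. -/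
structure IsLieHigherDerivation (R : Type*) {S : Type*} [CommRing R] [Ring S] [Algebra R S]
    (L : ℕ → S →ₗ[R] S) : Prop where
  map_zero : L 0 = LinearMap.id
  map_commutator : ∀ (k : ℕ) (x y : S),
    L k (x * y - y * x) = ∑ p ∈ antidiagonal k, (L p.1 x * L p.2 y - L p.2 y * L p.1 x)

/-- `L = D + τ` with `D` a higher derivation and `τ = (τ k)_{k ≥ 1}` a sequence of linear maps that
take values in the center and vanish at commutators. (The value of `τ` at the index `0` plays no
role.) -/
def IsProperLieHigherDerivation (R : Type*) {S : Type*} [CommRing R] [Ring S] [Algebra R S]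
    (L : ℕ → S →ₗ[R] S) : Prop :=
  IsLieHigherDerivation R L ∧
  ∃ D τ : ℕ → S →ₗ[R] S, IsHigherDerivation R D ∧
    (∀ k, 1 ≤ k → ∀ x, τ k x ∈ Set.center S) ∧
    (∀ k, 1 ≤ k → ∀ x y, τ k (x * y - y * x) = 0) ∧
    ∀ k, 1 ≤ k → L k = D k + τ k

/-- The Lie higher derivation property: every Lie higher derivation is proper. -/
def HasLHDProperty (R S : Type*) [CommRing R] [Ring S] [Algebra R S] : Prop :=
  ∀ L : ℕ → S →ₗ[R] S, IsLieHigherDerivation R L → IsProperLieHigherDerivation R L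

/-- `2 m = 0` implies `m = 0`. -/
def IsTwoTorsionFree (M : Type*) [AddCommGroup M] : Prop :=
  ∀ m : M, (2 : ℕ) • m = 0 → m = 0

/-- A Morita context on `R`-algebras `A`, `B`, an `(A, B)`-bimodule `M` and a `(B, A)`-bimodule `N`.
Right actions are left actions of the opposite ring. A bimodule homomorphism `M ⊗_B N → A` is the
same as a biadditive map `M × N → A` that is `B`-balanced, left `A`-linear in `M` and right
`A`-linear in `N`; similarly for `N ⊗_A M → B`. The last two fields are the two commutative
diagrams `(m n) m' = m (n m')` and `(n m) n' = n (m n')`. -/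
structure MoritaContext (R A B M N : Type*) [CommRing R] [Ring A] [Ring B] [Algebra R A]
    [Algebra R B] [AddCommGroup M] [AddCommGroup N]
    [Module R M] [Module A M] [Module Bᵐᵒᵖ M] [SMulCommClass A Bᵐᵒᵖ M]
    [IsScalarTower R A M] [IsScalarTower R Bᵐᵒᵖ M]
    [Module R N] [Module B N] [Module Aᵐᵒᵖ N] [SMulCommClass B Aᵐᵒᵖ N]
    [IsScalarTower R B N] [IsScalarTower R Aᵐᵒᵖ N] where
  Φ : M →+ N →+ A
  Ψ : N →+ M →+ B
  Φ_balanced : ∀ (m : M) (b : B) (n : N), Φ (op b • m) n = Φ m (b • n)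
  Φ_smul_left : ∀ (a : A) (m : M) (n : N), Φ (a • m) n = a * Φ m n
  Φ_smul_right : ∀ (m : M) (n : N) (a : A), Φ m (op a • n) = Φ m n * a
  Ψ_balanced : ∀ (n : N) (a : A) (m : M), Ψ (op a • n) m = Ψ n (a • m)
  Ψ_smul_left : ∀ (b : B) (n : N) (m : M), Ψ (b • n) m = b * Ψ n m
  Ψ_smul_right : ∀ (n : N) (m : M) (b : B), Ψ n (op b • m) = Ψ n m * b
  Φ_smul_eq : ∀ (m : M) (n : N) (m' : M), Φ m n • m' = op (Ψ n m') • m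
  Ψ_smul_eq : ∀ (n : N) (m : M) (n' : N), Ψ n m • n' = op (Φ m n') • n

namespace MoritaContext

section

variable {R A B M N : Type*} [CommRing R] [Ring A] [Ring B] [Algebra R A]
  [Algebra R B] [AddCommGroup M] [AddCommGroup N]
  [Module R M] [Module A M] [Module Bᵐᵒᵖ M] [SMulCommClass A Bᵐᵒᵖ M]
  [IsScalarTower R A M] [IsScalarTower R Bᵐᵒᵖ M]
  [Module R N] [Module B N] [Module Aᵐᵒᵖ N] [SMulCommClass B Aᵐᵒᵖ N]
  [IsScalarTower R B N] [IsScalarTower R Aᵐᵒᵖ N]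

/-- The underlying set of the generalized matrix algebra: matrices `(a m; n b)`. -/
@[ext]
structure GenMatrix (C : MoritaContext R A B M N) where
  a : A
  m : M
  n : N
  b : B

namespace GenMatrix

variable {C : MoritaContext R A B M N}

instance : Zero C.GenMatrix := ⟨⟨0, 0, 0, 0⟩⟩
instance : One C.GenMatrix := ⟨⟨1, 0, 0, 1⟩⟩
instance : Add C.GenMatrix := ⟨fun x y => ⟨x.a + y.a, x.m + y.m, x.n + y.n, x.b + y.b⟩⟩
instance : Neg C.GenMatrix := ⟨fun x => ⟨-x.a, -x.m, -x.n, -x.b⟩⟩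
instance : Mul C.GenMatrix := ⟨fun x y =>
  ⟨x.a * y.a + C.Φ x.m y.n, x.a • y.m + op y.b • x.m,
    op y.a • x.n + x.b • y.n, C.Ψ x.n y.m + x.b * y.b⟩⟩
instance : SMul R C.GenMatrix := ⟨fun r x => ⟨r • x.a, r • x.m, r • x.n, r • x.b⟩⟩

@[simp] theorem zero_a : (0 : C.GenMatrix).a = 0 := rfl
@[simp] theorem zero_m : (0 : C.GenMatrix).m = 0 := rfl
@[simp] theorem zero_n : (0 : C.GenMatrix).n = 0 := rfl
@[simp] theorem zero_b : (0 : C.GenMatrix).b = 0 := rfl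
@[simp] theorem one_a : (1 : C.GenMatrix).a = 1 := rfl
@[simp] theorem one_m : (1 : C.GenMatrix).m = 0 := rfl
@[simp] theorem one_n : (1 : C.GenMatrix).n = 0 := rfl
@[simp] theorem one_b : (1 : C.GenMatrix).b = 1 := rfl
@[simp] theorem add_a (x y : C.GenMatrix) : (x + y).a = x.a + y.a := rfl
@[simp] theorem add_m (x y : C.GenMatrix) : (x + y).m = x.m + y.m := rfl
@[simp] theorem add_n (x y : C.GenMatrix) : (x + y).n = x.n + y.n := rfl
@[simp] theorem add_b (x y : C.GenMatrix) : (x + y).b = x.b + y.b := rfl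
@[simp] theorem neg_a (x : C.GenMatrix) : (-x).a = -x.a := rfl
@[simp] theorem neg_m (x : C.GenMatrix) : (-x).m = -x.m := rfl
@[simp] theorem neg_n (x : C.GenMatrix) : (-x).n = -x.n := rfl
@[simp] theorem neg_b (x : C.GenMatrix) : (-x).b = -x.b := rfl
@[simp] theorem mul_a (x y : C.GenMatrix) : (x * y).a = x.a * y.a + C.Φ x.m y.n := rfl
@[simp] theorem mul_m (x y : C.GenMatrix) : (x * y).m = x.a • y.m + op y.b • x.m := rfl
@[simp] theorem mul_n (x y : C.GenMatrix) : (x * y).n = op y.a • x.n + x.b • y.n := rfl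
@[simp] theorem mul_b (x y : C.GenMatrix) : (x * y).b = C.Ψ x.n y.m + x.b * y.b := rfl
@[simp] theorem smul_a (r : R) (x : C.GenMatrix) : (r • x).a = r • x.a := rfl
@[simp] theorem smul_m (r : R) (x : C.GenMatrix) : (r • x).m = r • x.m := rfl
@[simp] theorem smul_n (r : R) (x : C.GenMatrix) : (r • x).n = r • x.n := rfl
@[simp] theorem smul_b (r : R) (x : C.GenMatrix) : (r • x).b = r • x.b := rfl

/-- The ring structure given by the usual matrix operations. -/
instance : Ring C.GenMatrix where
  add_assoc x y z := by ext <;> simp [add_assoc]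
  zero_add x := by ext <;> simp
  add_zero x := by ext <;> simp
  add_comm x y := by ext <;> simp [add_comm]
  neg_add_cancel x := by ext <;> simp
  nsmul := nsmulRec
  zsmul := zsmulRec
  zero_mul x := by ext <;> simp
  mul_zero x := by ext <;> simp
  one_mul x := by ext <;> simp
  mul_one x := by ext <;> simp
  left_distrib x y z := by
    ext <;> simp [mul_add, add_smul, smul_add] <;> abel
  right_distrib x y z := by
    ext <;> simp [add_mul, add_smul, smul_add] <;> abel
  mul_assoc x y z := by
    ext
    · simp [mul_add, add_mul, mul_assoc, C.Φ_balanced, C.Φ_smul_left, C.Φ_smul_right]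
      abel
    · simp [add_smul, smul_add, mul_smul, C.Φ_smul_eq, smul_comm x.a (op z.b) y.m]
      abel
    · simp [add_smul, smul_add, mul_smul, C.Ψ_smul_eq, smul_comm x.b (op z.a) y.n]
      abel
    · simp [mul_add, add_mul, mul_assoc, C.Ψ_balanced, C.Ψ_smul_left, C.Ψ_smul_right]
      abel

instance : Module R C.GenMatrix where
  one_smul x := by ext <;> simp
  mul_smul r s x := by ext <;> simp [mul_smul]
  smul_zero r := by ext <;> simp
  smul_add r x y := by ext <;> simp
  add_smul r s x := by ext <;> simp [add_smul]
  zero_smul x := by ext <;> simp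

theorem Φ_smul_scalar_left (C : MoritaContext R A B M N) (r : R) (m : M) (n : N) :
    C.Φ (r • m) n = r • C.Φ m n := by
  rw [← algebraMap_smul A r m, C.Φ_smul_left, Algebra.smul_def]

theorem Φ_smul_scalar_right (C : MoritaContext R A B M N) (r : R) (m : M) (n : N) :
    C.Φ m (r • n) = r • C.Φ m n := by
  rw [← algebraMap_smul Aᵐᵒᵖ r n, MulOpposite.algebraMap_apply, C.Φ_smul_right,
    Algebra.smul_def, Algebra.commutes]

theorem Ψ_smul_scalar_left (C : MoritaContext R A B M N) (r : R) (n : N) (m : M) :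
    C.Ψ (r • n) m = r • C.Ψ n m := by
  rw [← algebraMap_smul B r n, C.Ψ_smul_left, Algebra.smul_def]

theorem Ψ_smul_scalar_right (C : MoritaContext R A B M N) (r : R) (n : N) (m : M) :
    C.Ψ n (r • m) = r • C.Ψ n m := by
  rw [← algebraMap_smul Bᵐᵒᵖ r m, MulOpposite.algebraMap_apply, C.Ψ_smul_right,
    Algebra.smul_def, Algebra.commutes]

/-- The generalized matrix algebra is an `R`-algebra, with entrywise scalar multiplication. -/
instance : Algebra R C.GenMatrix :=
  Algebra.ofModule
    (fun r x y => by
      ext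
      · simp [smul_add, Φ_smul_scalar_left]
      · simp [smul_add, smul_assoc, smul_algebra_smul_comm r (op y.b) x.m]
      · simp [smul_add, smul_assoc, smul_algebra_smul_comm r (op y.a) x.n]
      · simp [smul_add, Ψ_smul_scalar_left])
    (fun r x y => by
      ext
      · simp [smul_add, Φ_smul_scalar_right]
      · simp [smul_add, smul_assoc, smul_algebra_smul_comm r x.a y.m]
      · simp [smul_add, smul_assoc, smul_algebra_smul_comm r x.b y.n]
      · simp [smul_add, Ψ_smul_scalar_right])

end GenMatrix

/-- `aM = 0 = Na` implies `a = 0`, and `Mb = 0 = bN` implies `b = 0`. -/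
def IsWeaklyFaithful (_C : MoritaContext R A B M N) : Prop :=
  (∀ a : A, (∀ m : M, a • m = 0) → (∀ n : N, op a • n = 0) → a = 0) ∧
  (∀ b : B, (∀ m : M, op b • m = 0) → (∀ n : N, b • n = 0) → b = 0)

end

end MoritaContext

/-! ### The `X`-adic filtration of power series over a noncommutative ring -/

namespace PowerSeries

section Filtration

variable {S : Type*} [Ring S]

/-! Put a sequence of maps `L k` into one generating series `L : S → S⟦X⟧`. A Lie higher derivation
becomes a Lie homomorphism lifting the identity modulo `X`, and a higher derivation a multiplicative
such lift. The task is to write `L` as a multiplicative lift plus a map into the center. Everything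
is done with complementary idempotents `e`, `f` of a ring `S`, here the diagonal idempotents of the
generalized matrix algebra.

Since `L e ≡ e` modulo `X`, a unit `≡ 1` conjugates `L e` into the diagonal (`exists_conj_commute`).
The corner `eSf` is an eigenspace of `ad e`, so `L` maps it to eigenvectors of `ad (L e)`. As `L e`
is a small diagonal perturbation of `e` and there is no 2-torsion off the diagonal, these lie in the
corresponding corner of `S⟦X⟧` (`eigenvector`); likewise for `fSe` and the diagonal.

The wrong diagonal part of `L a`, for `a` in `eSe`, commutes with the lifts of `fSf`, because `a`
does. So it is central in its corner and, by the condition on centers, extends to a central series,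
uniquely by weak faithfulness. Subtracting these central series gives a map `D` that preserves all
four corners (`exists_isSplitLift`).

Multiplicativity of `D` on diagonal times off-diagonal products is the Lie identity, and on diagonal
products it follows from faithfulness. For `m * n` with `m`, `n` off the diagonal the defect is the
`e`-part of a central element; absence of 2-torsion and of zero divisors makes it vanish
(`map_mul_ef_fe`). -/

theorem X_pow_dvd_mul {m n : ℕ} {x y : S⟦X⟧} (hx : X ^ m ∣ x) (hy : X ^ n ∣ y) :
    X ^ (m + n) ∣ x * y := by
  obtain ⟨x, rfl⟩ := hx
  obtain ⟨y, rfl⟩ := hy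
  refine ⟨x * y, ?_⟩
  rw [mul_assoc, ← mul_assoc x, ← X_pow_mul, pow_add]
  simp only [mul_assoc]

theorem X_pow_dvd_mul_left {n : ℕ} {y : S⟦X⟧} (x : S⟦X⟧) (hy : X ^ n ∣ y) : X ^ n ∣ x * y := by
  simpa using X_pow_dvd_mul (m := 0) (x := x) (by simp) hy

theorem eq_zero_of_forall_X_pow_dvd {x : S⟦X⟧} (h : ∀ n, X ^ n ∣ x) : x = 0 := by
  ext n
  exact X_pow_dvd_iff.1 (h (n + 1)) n n.lt_succ_self

theorem eq_zero_of_dvd_succ {x : S⟦X⟧} (h : ∀ n, X ^ n ∣ x → X ^ (n + 1) ∣ x) : x = 0 :=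
  eq_zero_of_forall_X_pow_dvd fun n => by
    induction n with
    | zero => simp
    | succ n ih => exact h n ih

/-- The completeness of the power series ring, in the form of the contraction principle. -/
theorem exists_fixedPoint_of_contraction (F : S⟦X⟧ → S⟦X⟧)
    (hF : ∀ n x y, X ^ n ∣ x - y → X ^ (n + 1) ∣ F x - F y) : ∃ x, F x = x := by
  have step : ∀ n, X ^ n ∣ F^[n + 1] 0 - F^[n] 0 := by
    intro n
    induction n with
    | zero => simp
    | succ n ih =>
      rw [Function.iterate_succ_apply' F (n + 1), Function.iterate_succ_apply' F n]
      exact hF n _ _ (by simpa [Function.iterate_succ_apply'] using ih)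
  have cauchy : ∀ n k, X ^ n ∣ F^[n + k] 0 - F^[n] 0 := by
    intro n k
    induction k with
    | zero => simp
    | succ k ih =>
      have h := dvd_add ((pow_dvd_pow X (Nat.le_add_right n k)).trans (step (n + k))) ih
      simpa [← add_assoc] using h
  -- The iterates from the `(k + 1)`-st on agree modulo `X ^ (k + 1)`, so their `k`-th coefficient
  -- is final.
  let v : S⟦X⟧ := mk fun k => coeff k (F^[k + 1] 0)
  have hv : ∀ n, X ^ n ∣ v - F^[n] 0 := by
    intro n
    rw [X_pow_dvd_iff]
    intro i hi
    obtain ⟨k, rfl⟩ := Nat.exists_eq_add_of_lt hi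
    have h := X_pow_dvd_iff.1 (cauchy (i + 1) k) i i.lt_succ_self
    rw [map_sub, sub_eq_zero] at h
    rw [map_sub, coeff_mk, sub_eq_zero, ← h, show i + k + 1 = i + 1 + k by omega]
  refine ⟨v, sub_eq_zero.1 (eq_zero_of_forall_X_pow_dvd fun n => ?_)⟩
  have h₁ := hF n _ _ (hv n)
  have h₂ := hv (n + 1)
  rw [Function.iterate_succ_apply'] at h₂
  exact (pow_dvd_pow X n.le_succ).trans (by simpa using dvd_sub h₁ h₂)

/-- An element that bracketing with a multiple of `X` fixes is zero. -/
theorem eq_zero_of_eq_commutator {r y : S⟦X⟧} (hr : X ∣ r) (h : y = r * y - y * r) : y = 0 := by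
  have hr : X ^ 1 ∣ r := by simpa using hr
  refine eq_zero_of_dvd_succ fun n hn => ?_
  rw [h]
  exact dvd_sub (by simpa [add_comm] using X_pow_dvd_mul hr hn) (X_pow_dvd_mul hn hr)

/-- Bracketing with `r` raises the `X`-adic order, and dividing by 2 in the coefficients does not
lower it. -/
theorem eq_zero_of_two_eq_commutator {r y : S⟦X⟧} (hr : X ∣ r)
    (htf : ∀ k, coeff k y + coeff k y = 0 → coeff k y = 0)
    (h : y + y = r * y - y * r) : y = 0 := by
  have hr : X ^ 1 ∣ r := by simpa using hr
  refine eq_zero_of_dvd_succ fun n hn => ?_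
  have h' : X ^ (n + 1) ∣ y + y := by
    rw [h]
    exact dvd_sub (by simpa [add_comm] using X_pow_dvd_mul hr hn) (X_pow_dvd_mul hn hr)
  rw [X_pow_dvd_iff] at h' ⊢
  intro i hi
  exact htf i (by simpa using h' i hi)

/-- If `w` commutes with `L x ≡ x mod X` for all `x` in a set that is stable under the coefficients
of `L`, then the coefficients of `w` commute with this set. -/
theorem coeff_commute_of_commute_lift {L : S → S⟦X⟧} {V : Set S}
    (h₀ : ∀ x ∈ V, constantCoeff (L x) = x) (hV : ∀ x ∈ V, ∀ k, coeff k (L x) ∈ V) {w : S⟦X⟧}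
    (hw : ∀ x ∈ V, w * L x = L x * w) (k : ℕ) : ∀ x ∈ V, coeff k w * x = x * coeff k w := by
  induction k using Nat.strong_induction_on with
  | _ k ih =>
    intro x hx
    have h := congrArg (coeff k) (hw x hx)
    rw [coeff_mul, coeff_mul, ← Finset.Nat.sum_antidiagonal_swap, ← sub_eq_zero,
      ← Finset.sum_sub_distrib, Finset.sum_eq_single (0, k)] at h
    -- Every other term brackets a lower coefficient of `w` with an element of `V`, hence is zero by
    -- induction.
    · simpa [h₀ x hx, sub_eq_zero] using h
    · rintro ⟨i, j⟩ hij hne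
      rw [HasAntidiagonal.mem_antidiagonal] at hij
      have hj : j < k := by
        have : i ≠ 0 := by rintro rfl; simp_all
        simp only at hij
        omega
      exact sub_eq_zero.2 (ih j hj _ (hV x hx i))
    · simp

theorem commute_of_coeff {w y : S⟦X⟧} (h : ∀ i j, coeff i w * coeff j y = coeff j y * coeff i w) :
    w * y = y * w := by
  ext k
  rw [coeff_mul, coeff_mul, ← Finset.Nat.sum_antidiagonal_swap]
  exact Finset.sum_congr rfl fun p _ => h _ _

theorem mem_center_iff_coeff {w : S⟦X⟧} :
    w ∈ Set.center S⟦X⟧ ↔ ∀ k, coeff k w ∈ Set.center S := by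
  simp only [Semigroup.mem_center_iff]
  constructor
  · intro h k s
    simpa using congrArg (coeff k) (h (C s))
  · exact fun h y => (commute_of_coeff fun i j => (h i _).symm).symm

theorem exists_eq_X_pow_mul {x : S⟦X⟧} (hx : x ≠ 0) :
    ∃ n y, x = X ^ n * y ∧ constantCoeff y ≠ 0 := by
  by_contra! H
  refine hx (eq_zero_of_dvd_succ fun n hn => ?_)
  obtain ⟨y, rfl⟩ := hn
  obtain ⟨z, rfl⟩ := X_dvd_iff.2 (H n y rfl)
  exact ⟨z, by rw [pow_succ, mul_assoc]⟩

end Filtration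

end PowerSeries

/-! ### Peirce corners -/

section

open PowerSeries

variable {S : Type*} [Ring S]

/-- `x` lies in the Peirce corner `e S f`, for idempotents `e`, `f`. -/
def InPeirceCorner (e f x : S) : Prop := e * x = x ∧ x * f = x

/-- Complementary idempotents. -/
structure IsComplementary (e f : S) : Prop where
  add_eq : e + f = 1
  left_idem : e * e = e
  right_idem : f * f = f
  mul_eq : e * f = 0
  mul_eq' : f * e = 0

namespace InPeirceCorner

variable {e f g h x y : S}

theorem sub (hx : InPeirceCorner e f x) (hy : InPeirceCorner e f y) : InPeirceCorner e f (x - y) :=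
  ⟨by rw [mul_sub, hx.1, hy.1], by rw [sub_mul, hx.2, hy.2]⟩

theorem mul (hx : InPeirceCorner e f x) (hy : InPeirceCorner g h y) : InPeirceCorner e h (x * y) :=
  ⟨by rw [← mul_assoc, hx.1], by rw [mul_assoc, hy.2]⟩

theorem mul_eq_zero (hx : InPeirceCorner e f x) (hy : InPeirceCorner g h y) (hfg : f * g = 0) :
    x * y = 0 := by
  rw [← hx.2, ← hy.1, mul_assoc, ← mul_assoc f, hfg, zero_mul, mul_zero]

theorem left_mul_eq_zero (hx : InPeirceCorner e f x) (hge : g * e = 0) : g * x = 0 := by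
  rw [← hx.1, ← mul_assoc, hge, zero_mul]

theorem right_mul_eq_zero (hx : InPeirceCorner e f x) (hfg : f * g = 0) : x * g = 0 := by
  rw [← hx.2, mul_assoc, hfg, mul_zero]

theorem mid (he : e * e = e) (hf : f * f = f) (x : S) : InPeirceCorner e f (e * x * f) :=
  ⟨by rw [← mul_assoc, ← mul_assoc, he], by rw [mul_assoc, hf]⟩

theorem mid_eq (hx : InPeirceCorner e f x) : e * x * f = x := by rw [hx.1, hx.2]

/-- Transfers the corner hypotheses on `S` to `S⟦X⟧`, one coefficient at a time. -/
theorem iff_coeff {y : S⟦X⟧} :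
    InPeirceCorner (C e) (C f) y ↔ ∀ k, InPeirceCorner e f (coeff k y) := by
  constructor
  · exact fun h k => ⟨by simpa using congrArg (coeff k) h.1, by simpa using congrArg (coeff k) h.2⟩
  · exact fun h => ⟨by ext k; simpa using (h k).1, by ext k; simpa using (h k).2⟩

end InPeirceCorner

namespace IsComplementary

variable {e f x : S}

theorem symm (h : IsComplementary e f) : IsComplementary f e :=
  ⟨by rw [add_comm, h.add_eq], h.right_idem, h.left_idem, h.mul_eq', h.mul_eq⟩

theorem map_C (h : IsComplementary e f) : IsComplementary (C e : S⟦X⟧) (C f) := by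
  constructor <;>
    simp only [← map_mul, ← map_add, h.add_eq, h.left_idem, h.right_idem, h.mul_eq, h.mul_eq',
      map_one, map_zero]

theorem right_eq (h : IsComplementary e f) : f = 1 - e := by
  rw [← h.add_eq, add_sub_cancel_left]

theorem sum_corners (h : IsComplementary e f) (x : S) :
    x = e * x * e + e * x * f + (f * x * e + f * x * f) := by
  rw [← mul_add, ← mul_add, h.add_eq, mul_one, mul_one, ← add_mul, h.add_eq, one_mul]

theorem commute_iff (h : IsComplementary e f) : e * x = x * e ↔ f * x = x * f := by
  rw [h.right_eq, sub_mul, mul_sub, one_mul, mul_one, sub_right_inj]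

theorem commute_of_corner (_h : IsComplementary e f) (hx : InPeirceCorner e e x) : e * x = x * e :=
  hx.1.trans hx.2.symm

theorem commute_of_corner' (h : IsComplementary e f) (hx : InPeirceCorner f f x) : e * x = x * e :=
  h.commute_iff.2 (hx.1.trans hx.2.symm)

theorem commute_of_mid_eq_zero (h : IsComplementary e f) (h₁ : e * x * f = 0)
    (h₂ : f * x * e = 0) : e * x = x * e := by
  rw [h.right_eq, mul_sub, mul_one, sub_eq_zero] at h₁
  rw [h.right_eq, sub_mul, sub_mul, one_mul, sub_eq_zero] at h₂
  rw [h₁, h₂]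

end IsComplementary

/-! ### Conditions on the two diagonal corners -/

/-- The hypotheses on the ring at the diagonal corner `e S e`. -/
structure IsGoodCorner (e f : S) : Prop where
  two_torsion_free : ∀ x, InPeirceCorner e f x → x + x = 0 → x = 0
  faithful : ∀ x, InPeirceCorner e e x → (∀ m, InPeirceCorner e f m → x * m = 0) →
    (∀ n, InPeirceCorner f e n → n * x = 0) → x = 0
  exists_center : ∀ x, InPeirceCorner e e x → (∀ y, InPeirceCorner e e y → x * y = y * x) →
    ∃ z ∈ Set.center S, e * z = x
  domain : ∀ x y, InPeirceCorner e e x → InPeirceCorner e e y → x * y = 0 → x = 0 ∨ y = 0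

/-- The hypotheses at both diagonal corners. -/
structure IsGoodPair (e f : S) : Prop where
  compl : IsComplementary e f
  left : IsGoodCorner e f
  right : IsGoodCorner f e

namespace IsGoodPair

variable {e f : S}

theorem symm (h : IsGoodPair e f) : IsGoodPair f e := ⟨h.compl.symm, h.right, h.left⟩

/-- Such a `z` lies in `fSf` and kills both off-diagonal corners, since it can be moved past their
elements to meet `e`. This gives uniqueness of central extensions. -/
theorem eq_zero_of_center (h : IsGoodPair e f) {z : S} (hz : z ∈ Set.center S)
    (hez : e * z = 0) : z = 0 := by
  rw [Semigroup.mem_center_iff] at hz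
  have hfz : f * z = z := by
    conv_rhs => rw [← one_mul z, ← h.compl.add_eq, add_mul, hez, zero_add]
  refine h.right.faithful z ⟨hfz, by rw [← hz, hfz]⟩ (fun m hm => ?_) fun n hn => ?_
  · rw [← hz, ← hm.2, mul_assoc, hez, mul_zero]
  · rw [hz, ← hn.1, ← mul_assoc, ← hz, hez, zero_mul]

theorem eq_zero_of_center' (h : IsGoodPair e f) {z : S⟦X⟧} (hz : z ∈ Set.center S⟦X⟧)
    (hez : C e * z = 0) : z = 0 := by
  ext k
  exact h.eq_zero_of_center (mem_center_iff_coeff.1 hz k) (by simpa using congrArg (coeff k) hez)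

theorem two_torsion_free' (h : IsGoodPair e f) {x : S⟦X⟧} (hx : InPeirceCorner (C e) (C f) x)
    (hxx : x + x = 0) : x = 0 := by
  ext k
  exact h.left.two_torsion_free _ (InPeirceCorner.iff_coeff.1 hx k)
    (by simpa using congrArg (coeff k) hxx)

/-- The lowest nonzero coefficients of `x` and `y` lie in `eSe`, and their product is a coefficient
of `x * y`. -/
theorem domain' (h : IsGoodPair e f) {x y : S⟦X⟧} (hx : InPeirceCorner (C e) (C e) x)
    (hy : InPeirceCorner (C e) (C e) y) (hxy : x * y = 0) : x = 0 ∨ y = 0 := by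
  by_contra! H
  obtain ⟨i, x, rfl, hx₀⟩ := exists_eq_X_pow_mul H.1
  obtain ⟨j, y, rfl, hy₀⟩ := exists_eq_X_pow_mul H.2
  have hx' := InPeirceCorner.iff_coeff.1 hx i
  have hy' := InPeirceCorner.iff_coeff.1 hy j
  have hxy' : X ^ (i + j) * (x * y) = 0 := by
    rw [← hxy, mul_assoc (X ^ i), ← mul_assoc x, ← X_pow_mul, pow_add]
    simp only [mul_assoc]
  have h₀ := congrArg (coeff (i + j)) hxy'
  simp only [coeff_X_pow_mul', le_refl, if_true, Nat.sub_self, coeff_zero_eq_constantCoeff_apply,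
    map_mul, map_zero] at h₀ hx' hy'
  exact (h.left.domain _ _ hx' hy' h₀).elim hx₀ hy₀

end IsGoodPair

end

section

open PowerSeries

variable {S : Type*} [Ring S] {e f : S}

/-! ### Conjugating a lift of an idempotent into the diagonal -/

/-- A power series `h ≡ e mod X` is conjugate, by a unit `u ≡ 1 mod X`, to one that commutes
with `e`. -/
theorem IsComplementary.exists_conj_commute (hc : IsComplementary e f) {h : S⟦X⟧}
    (hh : constantCoeff h = e) :
    ∃ u v : S⟦X⟧, constantCoeff u = 1 ∧ constantCoeff v = 1 ∧ u * v = 1 ∧ v * u = 1 ∧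
      C e * (v * h * u) = v * h * u * C e := by
  have hC := hc.map_C
  set E : S⟦X⟧ := C e
  set F : S⟦X⟧ := C f
  set o := E * h * F + F * h * E with ho
  set r := E * h * E + F * h * F - E with hr
  have hho : h = E + r + o := by
    conv_lhs => rw [hC.sum_corners h]
    rw [ho, hr]; abel
  have hEo : E * o + o * E = o := by
    rw [ho]
    simp only [mul_add, add_mul, mul_assoc, hC.left_idem, hC.mul_eq', mul_zero, zero_add]
    simp only [← mul_assoc, hC.left_idem, hC.mul_eq, zero_mul, add_zero]
  have hEr : E * r = r * E := by
    rw [hr]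
    simp only [mul_sub, sub_mul, mul_add, add_mul, mul_assoc, hC.left_idem, hC.mul_eq', mul_zero,
      add_zero]
    simp only [← mul_assoc, hC.left_idem, hC.mul_eq, zero_mul, add_zero]
  have hXo : X ^ 1 ∣ o := by
    rw [pow_one, X_dvd_iff]
    simp [ho, E, F, hh, hc.left_idem, hc.mul_eq, hc.mul_eq']
  have hXr : X ^ 1 ∣ r := by
    rw [pow_one, X_dvd_iff]
    simp [hr, E, F, hh, hc.left_idem, hc.mul_eq']
  -- With `h = E + r + o` split into diagonal and off-diagonal parts, `1 + v` conjugates `h` to `E +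
  -- r + o * v` exactly when `[E, v] = G v`. On off-diagonal elements `ad E` is its own inverse, so
  -- an off-diagonal solution is a fixed point of `v ↦ [E, G v]`, a contraction because `X` divides
  -- `o` and `r`.
  let G : S⟦X⟧ → S⟦X⟧ := fun v => v * o * v - o - (r * v - v * r)
  obtain ⟨v, hv⟩ := exists_fixedPoint_of_contraction (fun v => E * G v - G v * E) <| by
    intro n x y hxy
    have hG : X ^ (n + 1) ∣ G x - G y := by
      have : G x - G y = (x - y) * o * x + y * (o * (x - y)) - (r * (x - y) - (x - y) * r) := by
        simp only [G]; noncomm_ring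
      rw [this]
      refine dvd_sub (dvd_add (Dvd.dvd.mul_right (X_pow_dvd_mul hxy hXo) _)
        (X_pow_dvd_mul_left _ ?_)) (dvd_sub ?_ (X_pow_dvd_mul hxy hXr))
      · simpa [add_comm] using X_pow_dvd_mul hXo hxy
      · simpa [add_comm] using X_pow_dvd_mul hXr hxy
    have : E * G x - G x * E - (E * G y - G y * E) = E * (G x - G y) - (G x - G y) * E := by
      noncomm_ring
    simp only [this]
    exact dvd_sub (X_pow_dvd_mul_left _ hG) (Dvd.dvd.mul_right hG _)
  have hEE := hC.left_idem
  have hEv : E * v + v * E = v := by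
    rw [← hv]
    linear_combination (norm := noncomm_ring) hEE * G v - G v * hEE
  have hEvE : E * v * E = 0 := by
    linear_combination (norm := noncomm_ring) E * hEv - hEE * v
  have hEG : E * G v + G v * E = G v := by
    simp only [G]
    have h1 : E * (v * o * v) + v * o * v * E = v * o * v := by
      linear_combination (norm := noncomm_ring) hEv * o * v - v * hEo * v + v * o * hEv
    have h2 : E * (r * v - v * r) + (r * v - v * r) * E = r * v - v * r := by
      linear_combination (norm := noncomm_ring) hEr * v + v * hEr + r * hEv - hEv * r
    linear_combination (norm := noncomm_ring) h1 - h2 - hEo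
  have hEGE : E * G v * E = 0 := by
    linear_combination (norm := noncomm_ring) E * hEG - hEE * G v
  have hvG : E * v - v * E = G v := by
    have h3 : v = E * G v - G v * E := hv.symm
    linear_combination (norm := noncomm_ring)
      E * h3 - h3 * E + hEE * G v + G v * hEE - hEGE - hEGE + hEG
  have hXv : constantCoeff v = 0 := by
    have ho' : constantCoeff o = 0 := X_dvd_iff.1 (by simpa using hXo)
    have hr' : constantCoeff r = 0 := X_dvd_iff.1 (by simpa using hXr)
    rw [← hv]
    simp [G, ho', hr']
  have hconj : h * (1 + v) = (1 + v) * (E + r + o * v) := by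
    rw [hho]
    simp only [G] at hvG
    linear_combination (norm := noncomm_ring) hvG
  have hu : constantCoeff (1 + v) = ((1 : Sˣ) : S) := by simp [hXv]
  refine ⟨1 + v, invOfUnit (1 + v) 1, by simpa using hu, by simp,
    mul_invOfUnit _ _ hu, invOfUnit_mul _ _ hu, ?_⟩
  have hd : invOfUnit (1 + v) 1 * h * (1 + v) = E + r + o * v := by
    rw [mul_assoc, hconj, ← mul_assoc, invOfUnit_mul _ _ hu, one_mul]
  rw [hd]
  linear_combination (norm := noncomm_ring) hEr + hEo * v - o * hEv

/-! ### Eigenvectors of a diagonal lift of an idempotent -/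

/-- On the corners `ee`, `ff`, `fe`, `ad e` acts by 0, 0, -1, so there the equation reads `y = [r,
y]` or `2y = [r, y]`. Both force zero, because `X` divides `r`. -/
theorem IsGoodPair.eigenvector (hg : IsGoodPair e f) {r y : S⟦X⟧} (hXr : X ∣ r)
    (hr : C e * r = r * C e) (hy : (C e + r) * y - y * (C e + r) = y) :
    InPeirceCorner (C e) (C f) y := by
  have hC := hg.compl.map_C
  have hrF := hC.commute_iff.1 hr
  set E : S⟦X⟧ := C e
  set F : S⟦X⟧ := C f
  have hEE := hC.left_idem
  have hFE := hC.mul_eq'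
  have hEF := hC.mul_eq
  have h₁ : E * y * E = 0 := by
    refine eq_zero_of_eq_commutator hXr ?_
    linear_combination (norm := noncomm_ring)
      -E * hy * E + hr * y * E + E * y * hr + hEE * y * E - E * y * hEE
  have h₂ : F * y * F = 0 := by
    refine eq_zero_of_eq_commutator hXr ?_
    linear_combination (norm := noncomm_ring)
      -F * hy * F + hrF * y * F + F * y * hrF + hFE * y * F - F * y * hEF
  have h₃ : F * y * E = 0 := by
    refine eq_zero_of_two_eq_commutator hXr (fun k => ?_) ?_
    · exact hg.right.two_torsion_free _
        (InPeirceCorner.iff_coeff.1 (.mid hC.right_idem hC.left_idem y) k)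
    · linear_combination (norm := noncomm_ring)
        -F * hy * E + hrF * y * E + F * y * hr + hFE * y * E - F * y * hEE
  have hy' := hC.sum_corners y
  rw [h₁, h₂, h₃, zero_add, add_zero, add_zero] at hy'
  rw [hy']
  exact .mid hC.left_idem hC.right_idem y

/-- The analogue for eigenvalue 0: on the off-diagonal corners `ad e` is ±1, so the component equals
its bracket with `∓r`. -/
theorem IsComplementary.commute_of_commute_lift (hc : IsComplementary e f) {r y : S⟦X⟧}
    (hXr : X ∣ r) (hr : C e * r = r * C e) (hy : (C e + r) * y = y * (C e + r)) :
    C e * y = y * C e := by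
  have hC := hc.map_C
  have hrF := hC.commute_iff.1 hr
  set E : S⟦X⟧ := C e
  set F : S⟦X⟧ := C f
  have hEE := hC.left_idem
  have hFE := hC.mul_eq'
  have hEF := hC.mul_eq
  have h₁ : E * y * F = 0 := by
    refine eq_zero_of_eq_commutator (r := -r) (by simpa using hXr) ?_
    linear_combination (norm := noncomm_ring)
      E * hy * F - hr * y * F - E * y * hrF - hEE * y * F + E * y * hEF
  have h₂ : F * y * E = 0 := by
    refine eq_zero_of_eq_commutator hXr ?_
    linear_combination (norm := noncomm_ring)
      -F * hy * E + hrF * y * E + F * y * hr + hFE * y * E - F * y * hEE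
  exact hC.commute_of_mid_eq_zero h₁ h₂

end

section

open PowerSeries

variable {R S : Type*} [CommRing R] [Ring S] [Algebra R S] {e f : S}

/-! ### Lie homomorphisms into the power series ring -/

/-- A Lie homomorphism `S → S⟦X⟧` that lifts the identity of `S`; this is the same as a Lie higher
derivation. -/
structure IsLieLift (L : S →ₗ[R] S⟦X⟧) : Prop where
  const : ∀ x, constantCoeff (L x) = x
  map_commutator : ∀ x y, L (x * y - y * x) = L x * L y - L y * L x

/-- A Lie lift that preserves the off-diagonal corners and the diagonal. -/
structure IsDiagonalLieLift (e f : S) (L : S →ₗ[R] S⟦X⟧) : Prop extends IsLieLift L where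
  left : ∀ x, InPeirceCorner e f x → InPeirceCorner (C e) (C f) (L x)
  right : ∀ x, InPeirceCorner f e x → InPeirceCorner (C f) (C e) (L x)
  diag : ∀ x, e * x = x * e → C e * L x = L x * C e

theorem IsLieLift.conj {L : S →ₗ[R] S⟦X⟧} (hL : IsLieLift L) {u v : S⟦X⟧}
    (hu : constantCoeff u = 1) (hv : constantCoeff v = 1) (huv : u * v = 1) :
    IsLieLift (LinearMap.mulLeft R v ∘ₗ LinearMap.mulRight R u ∘ₗ L) where
  const x := by simp [hu, hv, hL.const]
  map_commutator x y := by
    simp only [LinearMap.comp_apply, LinearMap.mulLeft_apply, LinearMap.mulRight_apply,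
      hL.map_commutator]
    linear_combination (norm := noncomm_ring)
      v * L y * huv * L x * u - v * L x * huv * L y * u

theorem IsLieLift.isDiagonalLieLift {L : S →ₗ[R] S⟦X⟧} (hL : IsLieLift L) (hg : IsGoodPair e f)
    (he : C e * L e = L e * C e) : IsDiagonalLieLift e f L := by
  have hc := hg.compl
  have hXr : X ∣ L e - C e := by
    rw [X_dvd_iff]
    simp [hL.const]
  have hr : C e * (L e - C e) = (L e - C e) * C e := by rw [mul_sub, sub_mul, he]
  refine ⟨hL, fun x hx => ?_, fun x hx => ?_, fun x hx => ?_⟩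
  · refine hg.eigenvector hXr hr ?_
    rw [add_sub_cancel, ← hL.map_commutator, hx.1, hx.right_mul_eq_zero hc.mul_eq', sub_zero]
  -- With this `r`, `C f + r = 1 - L e`, whose bracket is minus that of `L e`.
  · refine hg.symm.eigenvector (r := -(L e - C e)) ((dvd_neg).2 hXr) ?_ ?_
    · rw [mul_neg, neg_mul, hc.map_C.commute_iff.1 hr]
    · have h := hL.map_commutator e x
      rw [hx.left_mul_eq_zero hc.mul_eq, hx.2, zero_sub, map_neg] at h
      rw [hc.map_C.right_eq]
      linear_combination (norm := noncomm_ring) h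
  · refine hc.commute_of_commute_lift hXr hr ?_
    rw [add_sub_cancel, ← sub_eq_zero, ← hL.map_commutator, hx, sub_self, map_zero]

theorem IsDiagonalLieLift.symm (hc : IsComplementary e f) {L : S →ₗ[R] S⟦X⟧}
    (hL : IsDiagonalLieLift e f L) : IsDiagonalLieLift f e L :=
  ⟨hL.toIsLieLift, hL.right, hL.left, fun x hx =>
    hc.map_C.commute_iff.1 (hL.diag x (hc.commute_iff.2 hx))⟩

/-! ### The central part -/

/-- A linear map whose values are multiples of `f` by central elements factors linearly through the
center, provided that multiplication by `f` is injective on the center. -/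
theorem exists_linearMap_center {V T : Type*} [AddCommGroup V] [Module R V] [Ring T] [Algebra R T]
    (f : T) (hf : ∀ z ∈ Set.center T, f * z = 0 → z = 0) (g : V →ₗ[R] T)
    (hg : ∀ x, ∃ z ∈ Set.center T, f * z = g x) :
    ∃ τ : V →ₗ[R] T, ∀ x, τ x ∈ Set.center T ∧ f * τ x = g x := by
  choose τ hτ hfτ using hg
  have key : ∀ z ∈ Subalgebra.center R T, ∀ z' ∈ Subalgebra.center R T, f * z = f * z' → z = z' :=
    fun z hz z' hz' h => sub_eq_zero.1 (hf _ (sub_mem hz hz') (by rw [mul_sub, h, sub_self]))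
  exact ⟨{  toFun := τ
            map_add' := fun x y => key _ (hτ _) _ (add_mem (hτ x) (hτ y)) (by
              rw [mul_add, hfτ, hfτ, hfτ, map_add])
            map_smul' := fun r x => key _ (hτ _) _ (Subalgebra.smul_mem _ (hτ x) r) (by
              rw [RingHom.id_apply, mul_smul_comm, hfτ, hfτ, map_smul]) },
    fun x => ⟨hτ x, hfτ x⟩⟩

/-- Elements of `eSe` and `fSf` commute, so `f L(a)` commutes with every `f L(y)`, `y` in `fSf`. Its
coefficients are then central in `fSf` and extend to the center of `S`. -/
theorem IsDiagonalLieLift.exists_center (hg : IsGoodPair e f) {L : S →ₗ[R] S⟦X⟧}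
    (hL : IsDiagonalLieLift e f L) :
    ∃ τ : S →ₗ[R] S⟦X⟧, ∀ x, τ x ∈ Set.center S⟦X⟧ ∧ C f * τ x = C f * L (e * x * e) := by
  have hc := hg.compl
  have hC := hc.map_C
  refine exists_linearMap_center (C f) (fun z => hg.symm.eq_zero_of_center')
    (LinearMap.mulLeft R (C f) ∘ₗ L ∘ₗ LinearMap.mulRight R e ∘ₗ LinearMap.mulLeft R e)
    fun x => ?_
  simp only [LinearMap.comp_apply, LinearMap.mulLeft_apply, LinearMap.mulRight_apply]
  have hx := InPeirceCorner.mid hc.left_idem hc.left_idem x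
  generalize e * x * e = a at hx
  have hFL : ∀ y, e * y = y * e → C f * L y = L y * C f := fun y hy =>
    hC.commute_iff.1 (hL.diag y hy)
  have hcor : ∀ y, e * y = y * e → InPeirceCorner (C f) (C f) (C f * L y) := fun y hy =>
    ⟨by rw [← mul_assoc, hC.right_idem], by rw [mul_assoc, ← hFL y hy, ← mul_assoc, hC.right_idem]⟩
  have ha := hc.commute_of_corner hx
  have hcomm : ∀ y, InPeirceCorner f f y → C f * L a * (C f * L y) = C f * L y * (C f * L a) := by
    intro y hy
    have hLc : L a * L y = L y * L a := by
      rw [← sub_eq_zero, ← hL.map_commutator, hx.mul_eq_zero hy hc.mul_eq,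
        hy.mul_eq_zero hx hc.mul_eq', sub_zero, map_zero]
    have h₁ := hFL a ha
    have h₂ := hFL y (hc.commute_of_corner' hy)
    have h₃ := hC.right_idem
    linear_combination (norm := noncomm_ring)
      C f * hLc * C f - C f * h₁ * L y + C f * C f * hLc - C f * hLc * C f + C f * h₂ * L a
  have hk := coeff_commute_of_commute_lift (L := fun y => C f * L y)
    (V := {y | InPeirceCorner f f y}) (fun y hy => by simpa [hL.const] using hy.1)
    (fun y hy => InPeirceCorner.iff_coeff.1 (hcor y (hc.commute_of_corner' hy))) hcomm
  choose z hz hfz using fun k => hg.right.exists_center _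
    (InPeirceCorner.iff_coeff.1 (hcor a ha) k) (hk k)
  refine ⟨PowerSeries.mk z, mem_center_iff_coeff.2 fun k => by simpa using hz k, ?_⟩
  ext k
  simpa using hfz k

/-! ### The multiplicative part -/

/-- A decomposition of a diagonal Lie lift as `D + τ`, where `τ` is central and `D` preserves the
corners. -/
structure IsSplitLift (e f : S) (D τ : S →ₗ[R] S⟦X⟧) : Prop where
  const : ∀ x, constantCoeff (D x) = x
  center : ∀ x, τ x ∈ Set.center S⟦X⟧
  lie : ∀ x y, D (x * y - y * x) + τ (x * y - y * x) = D x * D y - D y * D x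
  τ_left : ∀ x, InPeirceCorner e f x → τ x = 0
  τ_right : ∀ x, InPeirceCorner f e x → τ x = 0
  ee : ∀ x, InPeirceCorner e e x → InPeirceCorner (C e) (C e) (D x)
  ff : ∀ x, InPeirceCorner f f x → InPeirceCorner (C f) (C f) (D x)
  ef : ∀ x, InPeirceCorner e f x → InPeirceCorner (C e) (C f) (D x)
  fe : ∀ x, InPeirceCorner f e x → InPeirceCorner (C f) (C e) (D x)

/-- The map `τ` is `σ + ρ`, where `σ` removes the `f`-part of `L` on `eSe` and `ρ` the `e`-part of
`L` on `fSf`. -/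
theorem IsDiagonalLieLift.exists_isSplitLift (hg : IsGoodPair e f) {L : S →ₗ[R] S⟦X⟧}
    (hL : IsDiagonalLieLift e f L) : ∃ τ : S →ₗ[R] S⟦X⟧, IsSplitLift e f (L - τ) τ := by
  have hc := hg.compl
  have hC := hc.map_C
  obtain ⟨σ, hσ⟩ := hL.exists_center hg
  obtain ⟨ρ, hρ⟩ := (hL.symm hc).exists_center hg.symm
  have hσ₀ : ∀ x, e * x * e = 0 → σ x = 0 := fun x hx =>
    hg.symm.eq_zero_of_center' (hσ x).1 (by rw [(hσ x).2, hx, map_zero, mul_zero])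
  have hρ₀ : ∀ x, f * x * f = 0 → ρ x = 0 := fun x hx =>
    hg.eq_zero_of_center' (hρ x).1 (by rw [(hρ x).2, hx, map_zero, mul_zero])
  have hcen : ∀ x, (σ + ρ) x ∈ Set.center S⟦X⟧ := fun x =>
    Set.add_mem_center (hσ x).1 (hρ x).1
  have hcomm : ∀ x y, (σ + ρ) x * y = y * (σ + ρ) x := fun x y =>
    (Semigroup.mem_center_iff.1 (hcen x) y).symm
  have hconst : ∀ x, constantCoeff ((σ + ρ) x) = 0 := by
    intro x
    have h₁ : constantCoeff (σ x) = 0 := by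
      refine hg.symm.eq_zero_of_center
        (by simpa using mem_center_iff_coeff.1 (hσ x).1 0) ?_
      have := congrArg constantCoeff (hσ x).2
      simp only [map_mul, constantCoeff_C, hL.const] at this
      rw [this, ← mul_assoc, ← mul_assoc, hc.mul_eq', zero_mul, zero_mul]
    have h₂ : constantCoeff (ρ x) = 0 := by
      refine hg.eq_zero_of_center
        (by simpa using mem_center_iff_coeff.1 (hρ x).1 0) ?_
      have := congrArg constantCoeff (hρ x).2
      simp only [map_mul, constantCoeff_C, hL.const] at this
      rw [this, ← mul_assoc, ← mul_assoc, hc.mul_eq, zero_mul, zero_mul]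
    simp [h₁, h₂]
  have hτef : ∀ x, InPeirceCorner e f x → (σ + ρ) x = 0 := by
    intro x hx
    rw [LinearMap.add_apply, hσ₀ x, hρ₀ x, add_zero]
    · rw [hx.left_mul_eq_zero hc.mul_eq', zero_mul]
    · rw [mul_assoc, hx.right_mul_eq_zero hc.mul_eq', mul_zero]
  have hτfe : ∀ x, InPeirceCorner f e x → (σ + ρ) x = 0 := by
    intro x hx
    rw [LinearMap.add_apply, hσ₀ x, hρ₀ x, add_zero]
    · rw [mul_assoc, hx.right_mul_eq_zero hc.mul_eq, mul_zero]
    · rw [hx.left_mul_eq_zero hc.mul_eq, zero_mul]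
  have hdiag : ∀ x, e * x = x * e → C e * (L - (σ + ρ)) x = (L - (σ + ρ)) x * C e := by
    intro x hx
    rw [LinearMap.sub_apply, mul_sub, sub_mul, hL.diag x hx, hcomm]
  refine ⟨σ + ρ, ⟨fun x => ?_, hcen, fun x y => ?_, hτef, hτfe, fun x hx => ?_, fun x hx => ?_,
    fun x hx => ?_, fun x hx => ?_⟩⟩
  · rw [LinearMap.sub_apply, map_sub, hL.const, hconst, sub_zero]
  · rw [LinearMap.sub_apply, sub_add_cancel, hL.map_commutator, LinearMap.sub_apply,
      LinearMap.sub_apply]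
    linear_combination (norm := noncomm_ring) hcomm x (L y) - hcomm x ((σ + ρ) y) - hcomm y (L x)
  · have hF : C f * (L - (σ + ρ)) x = 0 := by
      rw [LinearMap.sub_apply, LinearMap.add_apply, hρ₀ x, add_zero, mul_sub, (hσ x).2,
        hx.mid_eq, sub_self]
      rw [hx.left_mul_eq_zero hc.mul_eq', zero_mul]
    have hE : C e * (L - (σ + ρ)) x = (L - (σ + ρ)) x := by
      conv_rhs => rw [← one_mul ((L - (σ + ρ)) x), ← hC.add_eq, add_mul, hF, add_zero]
    exact ⟨hE, by rw [← hdiag x (hc.commute_of_corner hx), hE]⟩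
  · have hE : C e * (L - (σ + ρ)) x = 0 := by
      rw [LinearMap.sub_apply, LinearMap.add_apply, hσ₀ x, zero_add, mul_sub, (hρ x).2,
        hx.mid_eq, sub_self]
      rw [hx.left_mul_eq_zero hc.mul_eq, zero_mul]
    have hF : C f * (L - (σ + ρ)) x = (L - (σ + ρ)) x := by
      conv_rhs => rw [← one_mul ((L - (σ + ρ)) x), ← hC.add_eq, add_mul, hE, zero_add]
    exact ⟨hF, by rw [← hC.commute_iff.1 (hdiag x (hc.commute_of_corner' hx)), hF]⟩
  · rw [LinearMap.sub_apply, hτef x hx, sub_zero]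
    exact hL.left x hx
  · rw [LinearMap.sub_apply, hτfe x hx, sub_zero]
    exact hL.right x hx

namespace IsSplitLift

variable {D τ : S →ₗ[R] S⟦X⟧}

theorem symm (h : IsSplitLift e f D τ) : IsSplitLift f e D τ :=
  ⟨h.const, h.center, h.lie, h.τ_right, h.τ_left, h.ff, h.ee, h.fe, h.ef⟩

/-- Here `m * a = 0`, so the product is a commutator, and `τ` vanishes on it. -/
theorem map_mul_ee_ef (hc : IsComplementary e f) (h : IsSplitLift e f D τ) {a m : S}
    (ha : InPeirceCorner e e a) (hm : InPeirceCorner e f m) : D (a * m) = D a * D m := by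
  have := h.lie a m
  rwa [hm.mul_eq_zero ha hc.mul_eq', sub_zero, h.τ_left _ (ha.mul hm), add_zero,
    (h.ef m hm).mul_eq_zero (h.ee a ha) hc.map_C.mul_eq', sub_zero] at this

theorem map_mul_fe_ee (hc : IsComplementary e f) (h : IsSplitLift e f D τ) {n a : S}
    (hn : InPeirceCorner f e n) (ha : InPeirceCorner e e a) : D (n * a) = D n * D a := by
  have := h.lie n a
  rwa [ha.mul_eq_zero hn hc.mul_eq, sub_zero, h.τ_right _ (hn.mul ha), add_zero,
    (h.ee a ha).mul_eq_zero (h.fe n hn) hc.map_C.mul_eq, sub_zero] at this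

theorem map_mul_ee (hg : IsGoodPair e f) (h : IsSplitLift e f D τ) {a b : S}
    (ha : InPeirceCorner e e a) (hb : InPeirceCorner e e b) : D (a * b) = D a * D b := by
  have hc := hg.compl
  have hC := hc.map_C
  set w := D (a * b) - D a * D b with hw
  have hwc : InPeirceCorner (C e) (C e) w := (h.ee _ (ha.mul hb)).sub ((h.ee a ha).mul (h.ee b hb))
  -- Both sides are zero. Stating annihilation as commutation lets `coeff_commute_of_commute_lift`
  -- pass it to the coefficients of `w`.
  have hm : ∀ m, InPeirceCorner e f m → w * D m = D m * w := by
    intro m hm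
    rw [(h.ef m hm).mul_eq_zero hwc hC.mul_eq', hw, sub_mul,
      ← h.map_mul_ee_ef hc (ha.mul hb) hm, mul_assoc (D a), ← h.map_mul_ee_ef hc hb hm,
      ← h.map_mul_ee_ef hc ha (hb.mul hm), mul_assoc, sub_self]
  have hn : ∀ n, InPeirceCorner f e n → w * D n = D n * w := by
    intro n hn
    rw [hwc.mul_eq_zero (h.fe n hn) hC.mul_eq, hw, mul_sub,
      ← h.map_mul_fe_ee hc hn (ha.mul hb), ← mul_assoc (D n), ← h.map_mul_fe_ee hc hn ha,
      ← h.map_mul_fe_ee hc (hn.mul ha) hb, mul_assoc, sub_self]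
  have hm' := coeff_commute_of_commute_lift (V := {m | InPeirceCorner e f m})
    (fun x _ => h.const x) (fun x hx => InPeirceCorner.iff_coeff.1 (h.ef x hx)) hm
  have hn' := coeff_commute_of_commute_lift (V := {m | InPeirceCorner f e m})
    (fun x _ => h.const x) (fun x hx => InPeirceCorner.iff_coeff.1 (h.fe x hx)) hn
  refine sub_eq_zero.1 (ext fun k => ?_)
  have hk := InPeirceCorner.iff_coeff.1 hwc k
  refine hg.left.faithful _ hk (fun m hm => ?_) fun n hn => ?_
  · rw [hm' k m hm, hm.mul_eq_zero hk hc.mul_eq']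
  · rw [← hn' k n hn, hk.mul_eq_zero hn hc.mul_eq]

theorem map_mul_ef_fe (hg : IsGoodPair e f) (h : IsSplitLift e f D τ) {m n : S}
    (hm : InPeirceCorner e f m) (hn : InPeirceCorner f e n) : D (m * n) = D m * D n := by
  have hc := hg.compl
  have hC := hc.map_C
  set c := τ (m * n - n * m) with hcdef
  have hcc : c ∈ Set.center S⟦X⟧ := h.center _
  have hcomm := Semigroup.mem_center_iff.1 hcc
  have hlie : c = D m * D n - D n * D m - D (m * n) + D (n * m) := by
    have := h.lie m n
    rw [map_sub D, ← hcdef] at this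
    linear_combination (norm := noncomm_ring) this
  have hDm := h.ef m hm
  have hDn := h.fe n hn
  have hDmn := h.ee _ (hm.mul hn)
  have hDnm := h.ff _ (hn.mul hm)
  have hEc : C e * c = D m * D n - D (m * n) := by
    rw [hlie, mul_add, mul_sub, mul_sub, (hDm.mul hDn).1, (hDn.mul hDm).left_mul_eq_zero hC.mul_eq,
      hDmn.1, hDnm.left_mul_eq_zero hC.mul_eq, sub_zero, add_zero]
  -- Multiplying by `D m` on the right sees only the `e`-part of `c`, on the left only its `f`-part.
  -- The two results are opposite, and `c` is central, so `2 * c * D m = 0`.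
  have hcDm : c * D m = D m * D n * D m - D (m * n * m) := by
    rw [hlie, add_mul, sub_mul, sub_mul, hDnm.mul_eq_zero hDm hC.mul_eq',
      (hDn.mul hDm).mul_eq_zero hDm hC.mul_eq', h.map_mul_ee_ef hc (hm.mul hn) hm, sub_zero,
      add_zero]
  have hDmc : D m * c = D (m * n * m) - D m * D n * D m := by
    rw [hlie, mul_add, mul_sub, mul_sub, hDm.mul_eq_zero hDmn hC.mul_eq',
      hDm.mul_eq_zero (hDm.mul hDn) hC.mul_eq', mul_assoc m,
      h.symm.map_mul_fe_ee hc.symm hm (hn.mul hm), zero_sub, sub_zero, mul_assoc]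
    abel
  have hcor : InPeirceCorner (C e) (C f) (c * D m) := by
    rw [hcDm]
    exact ((hDm.mul hDn).mul hDm).sub (h.ef _ ((hm.mul hn).mul hm))
  have hcDm₀ : c * D m = 0 := by
    refine hg.two_torsion_free' hcor ?_
    nth_rw 1 [← hcomm]
    rw [hDmc, hcDm, sub_add_sub_cancel, sub_self]
  have hE : C e * c = 0 := by
    have hprod : C e * c * (D m * D n) = 0 := by
      rw [mul_assoc, ← mul_assoc c, hcDm₀, zero_mul, mul_zero]
    -- If instead `D m * D n = 0`, then `c * D m = 0` reduces to `D (m * n * m) = 0`. Hence `(m * n)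
    -- ^ 2 = 0`, so `m * n = 0` and the defect vanishes anyway.
    refine (hg.domain' (hEc ▸ (hDm.mul hDn).sub hDmn) (hDm.mul hDn) hprod).elim id fun h₀ => ?_
    have h₁ : D (m * n * m) = 0 := by
      rw [hcDm, h₀, zero_mul, zero_sub, neg_eq_zero] at hcDm₀
      exact hcDm₀
    have h₂ : m * n * m = 0 := by
      rw [← h.const (m * n * m), h₁, map_zero]
    have h₃ : m * n = 0 := by
      have := hg.left.domain _ _ (hm.mul hn) (hm.mul hn) (by rw [← mul_assoc, h₂, zero_mul])
      exact this.elim id id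
    rw [hEc, h₀, h₃, map_zero, sub_zero]
  exact (sub_eq_zero.1 (hEc ▸ hE)).symm

/-- The corner-preserving part of a Lie lift is multiplicative. -/
theorem map_mul (hg : IsGoodPair e f) (h : IsSplitLift e f D τ) (x y : S) :
    D (x * y) = D x * D y := by
  have hc := hg.compl
  have hC := hc.map_C
  have hs := h.symm
  have hee := fun x => InPeirceCorner.mid hc.left_idem hc.left_idem x
  have hef := fun x => InPeirceCorner.mid hc.left_idem hc.right_idem x
  have hfe := fun x => InPeirceCorner.mid hc.right_idem hc.left_idem x
  have hff := fun x => InPeirceCorner.mid hc.right_idem hc.right_idem x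
  have hx := hc.sum_corners x
  have hy := hc.sum_corners y
  have h₁ := hee x
  have h₂ := hef x
  have h₃ := hfe x
  have h₄ := hff x
  have k₁ := hee y
  have k₂ := hef y
  have k₃ := hfe y
  have k₄ := hff y
  generalize e * x * e = a at *
  generalize e * x * f = m at *
  generalize f * x * e = n at *
  generalize f * x * f = b at *
  generalize e * y * e = a' at *
  generalize e * y * f = m' at *
  generalize f * y * e = n' at *
  generalize f * y * f = b' at *
  subst hx hy
  simp only [map_add, mul_add, add_mul]
  rw [h₁.mul_eq_zero k₃ hc.mul_eq, h₁.mul_eq_zero k₄ hc.mul_eq, h₂.mul_eq_zero k₁ hc.mul_eq',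
    h₂.mul_eq_zero k₂ hc.mul_eq', h₃.mul_eq_zero k₃ hc.mul_eq, h₃.mul_eq_zero k₄ hc.mul_eq,
    h₄.mul_eq_zero k₁ hc.mul_eq', h₄.mul_eq_zero k₂ hc.mul_eq',
    (h.ee _ h₁).mul_eq_zero (h.fe _ k₃) hC.mul_eq, (h.ee _ h₁).mul_eq_zero (h.ff _ k₄) hC.mul_eq,
    (h.ef _ h₂).mul_eq_zero (h.ee _ k₁) hC.mul_eq', (h.ef _ h₂).mul_eq_zero (h.ef _ k₂) hC.mul_eq',
    (h.fe _ h₃).mul_eq_zero (h.fe _ k₃) hC.mul_eq, (h.fe _ h₃).mul_eq_zero (h.ff _ k₄) hC.mul_eq,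
    (h.ff _ h₄).mul_eq_zero (h.ee _ k₁) hC.mul_eq', (h.ff _ h₄).mul_eq_zero (h.ef _ k₂) hC.mul_eq',
    h.map_mul_ee hg h₁ k₁, h.map_mul_ee_ef hc h₁ k₂, h.map_mul_ef_fe hg h₂ k₃,
    hs.map_mul_fe_ee hc.symm h₂ k₄, h.map_mul_fe_ee hc h₃ k₁, hs.map_mul_ef_fe hg.symm h₃ k₂,
    hs.map_mul_ee_ef hc.symm h₄ k₃, hs.map_mul_ee hg.symm h₄ k₄, map_zero]

end IsSplitLift

/-! ### From Lie lifts back to Lie higher derivations -/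

/-- Every Lie lift of a ring with a good pair of idempotents is the sum of a multiplicative lift
and a central map. -/
theorem IsLieLift.exists_mul_add_center (hg : IsGoodPair e f) {L : S →ₗ[R] S⟦X⟧}
    (hL : IsLieLift L) : ∃ D : S →ₗ[R] S⟦X⟧, (∀ x, constantCoeff (D x) = x) ∧
      (∀ x y, D (x * y) = D x * D y) ∧ ∀ x, L x - D x ∈ Set.center S⟦X⟧ := by
  obtain ⟨u, v, hu, hv, huv, hvu, he⟩ := hg.compl.exists_conj_commute (hL.const e)
  have hL' := hL.conj hu hv huv
  set L' := LinearMap.mulLeft R v ∘ₗ LinearMap.mulRight R u ∘ₗ L with hLdef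
  have hL'x : ∀ x, L' x = v * (L x * u) := fun x => rfl
  obtain ⟨τ, hτ⟩ := (hL'.isDiagonalLieLift hg (by
    simpa only [hL'x, mul_assoc] using he)).exists_isSplitLift hg
  refine ⟨LinearMap.mulLeft R u ∘ₗ LinearMap.mulRight R v ∘ₗ (L' - τ), fun x => ?_, fun x y => ?_,
    fun x => ?_⟩
  · have := hτ.const x
    simp only [LinearMap.comp_apply, LinearMap.mulLeft_apply, LinearMap.mulRight_apply,
      _root_.map_mul, hu, hv, this, mul_one, one_mul]
  · have := hτ.map_mul hg x y
    simp only [LinearMap.comp_apply, LinearMap.mulLeft_apply, LinearMap.mulRight_apply, this]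
    linear_combination (norm := noncomm_ring) -u * (L' - τ) x * hvu * (L' - τ) y * v
  -- Undoing the conjugation leaves the central part `τ x` unchanged.
  · have hcomm := Semigroup.mem_center_iff.1 (hτ.center x)
    have : L x - (LinearMap.mulLeft R u ∘ₗ LinearMap.mulRight R v ∘ₗ (L' - τ)) x = τ x := by
      simp only [LinearMap.comp_apply, LinearMap.mulLeft_apply, LinearMap.mulRight_apply,
        LinearMap.sub_apply, hL'x]
      linear_combination (norm := noncomm_ring)
        -huv * L x * u * v - L x * huv + hcomm u * v + τ x * huv
    rw [this]
    exact hτ.center x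

end

/-- A ring with a good pair of idempotents has the Lie higher derivation property. -/
theorem IsGoodPair.hasLHDProperty {R S : Type*} [CommRing R] [Ring S] [Algebra R S] {e f : S}
    (hg : IsGoodPair e f) : HasLHDProperty R S := by
  intro L hL
  let L' : S →ₗ[R] PowerSeries S :=
    { toFun := fun x => PowerSeries.mk fun k => L k x
      map_add' := fun x y => by ext k; simp
      map_smul' := fun r x => by
        ext k
        simp }
  have hL'x : ∀ k x, PowerSeries.coeff k (L' x) = L k x := fun k x =>
    PowerSeries.coeff_mk k fun k => L k x
  have hL' : IsLieLift L' := by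
    refine ⟨fun x => ?_, fun x y => ?_⟩
    · rw [← PowerSeries.coeff_zero_eq_constantCoeff_apply, hL'x, hL.map_zero, LinearMap.id_apply]
    · ext k
      rw [hL'x, hL.map_commutator, Finset.sum_sub_distrib, map_sub, PowerSeries.coeff_mul,
        PowerSeries.coeff_mul, ← Finset.Nat.sum_antidiagonal_swap (n := k)
          (f := fun p => PowerSeries.coeff p.1 (L' y) * PowerSeries.coeff p.2 (L' x))]
      simp only [hL'x, Prod.fst_swap, Prod.snd_swap]
  obtain ⟨D, hD₀, hD, hcen⟩ := hL'.exists_mul_add_center hg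
  let D' : ℕ → S →ₗ[R] S := fun k =>
    { toFun := fun x => PowerSeries.coeff k (D x)
      map_add' := fun x y => by simp
      map_smul' := fun r x => by simp }
  have hD'x : ∀ k x, D' k x = PowerSeries.coeff k (D x) := fun _ _ => rfl
  refine ⟨hL, D', fun k => L k - D' k, ⟨?_, fun k x y => ?_⟩, fun k _ x => ?_, fun k _ x y => ?_,
    fun k _ => (add_sub_cancel _ _).symm⟩
  · ext x
    rw [hD'x, PowerSeries.coeff_zero_eq_constantCoeff_apply, hD₀, LinearMap.id_apply]
  · simp only [hD'x, hD, PowerSeries.coeff_mul]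
  · rw [LinearMap.sub_apply, hD'x, ← hL'x, ← map_sub]
    exact PowerSeries.mem_center_iff_coeff.1 (hcen x) k
  · have hcomm := fun x => Semigroup.mem_center_iff.1 (hcen x)
    -- Since `L'` and `D` differ by central values, they have the same commutators.
    have h : L' (x * y - y * x) - D (x * y - y * x) = 0 := by
      rw [hL'.map_commutator, map_sub, hD, hD]
      linear_combination (norm := noncomm_ring) hcomm y (L' x) - hcomm x (D y)
    rw [LinearMap.sub_apply, hD'x, ← hL'x, ← map_sub, h, map_zero]

/-! ### The diagonal idempotents of a generalized matrix algebra -/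

namespace MoritaContext.GenMatrix

variable {R A B M N : Type*} [CommRing R] [Ring A] [Ring B] [Algebra R A]
  [Algebra R B] [AddCommGroup M] [AddCommGroup N]
  [Module R M] [Module A M] [Module Bᵐᵒᵖ M] [SMulCommClass A Bᵐᵒᵖ M]
  [IsScalarTower R A M] [IsScalarTower R Bᵐᵒᵖ M]
  [Module R N] [Module B N] [Module Aᵐᵒᵖ N] [SMulCommClass B Aᵐᵒᵖ N]
  [IsScalarTower R B N] [IsScalarTower R Aᵐᵒᵖ N]
  {C : MoritaContext R A B M N}

/-- The idempotent at the upper left corner. -/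
def e₁ : C.GenMatrix := ⟨1, 0, 0, 0⟩

/-- The idempotent at the lower right corner. -/
def e₂ : C.GenMatrix := ⟨0, 0, 0, 1⟩

theorem inPeirceCorner_e₁_e₁ {x : C.GenMatrix} :
    InPeirceCorner e₁ e₁ x ↔ x = ⟨x.a, 0, 0, 0⟩ := by
  simp [InPeirceCorner, GenMatrix.ext_iff, e₁, eq_comm]
  tauto

theorem inPeirceCorner_e₁_e₂ {x : C.GenMatrix} :
    InPeirceCorner e₁ e₂ x ↔ x = ⟨0, x.m, 0, 0⟩ := by
  simp [InPeirceCorner, GenMatrix.ext_iff, e₁, e₂, eq_comm]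
  tauto

theorem inPeirceCorner_e₂_e₁ {x : C.GenMatrix} :
    InPeirceCorner e₂ e₁ x ↔ x = ⟨0, 0, x.n, 0⟩ := by
  simp [InPeirceCorner, GenMatrix.ext_iff, e₁, e₂, eq_comm]
  tauto

theorem inPeirceCorner_e₂_e₂ {x : C.GenMatrix} :
    InPeirceCorner e₂ e₂ x ↔ x = ⟨0, 0, 0, x.b⟩ := by
  simp [InPeirceCorner, GenMatrix.ext_iff, e₂, eq_comm]
  tauto

theorem isComplementary : IsComplementary (e₁ : C.GenMatrix) e₂ := by
  constructor <;> ext <;> simp [e₁, e₂]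

theorem isGoodCorner_e₁ (hM : IsTwoTorsionFree M) (hfaithful : C.IsWeaklyFaithful)
    (hA : Set.center A ⊆ MoritaContext.GenMatrix.a '' Set.center C.GenMatrix)
    (hdomA : NoZeroDivisors A) : IsGoodCorner (e₁ : C.GenMatrix) e₂ where
  two_torsion_free x hx hxx := by
    rw [inPeirceCorner_e₁_e₂] at hx
    have h := hM x.m (by simpa [two_nsmul] using congrArg GenMatrix.m hxx)
    rw [hx, h]
    rfl
  faithful x hx hm hn := by
    rw [inPeirceCorner_e₁_e₁] at hx
    have h := hfaithful.1 x.a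
      (fun m => by
        simpa using congrArg GenMatrix.m (hm ⟨0, m, 0, 0⟩ (inPeirceCorner_e₁_e₂.2 rfl)))
      (fun n => by
        simpa using congrArg GenMatrix.n (hn ⟨0, 0, n, 0⟩ (inPeirceCorner_e₂_e₁.2 rfl)))
    rw [hx, h]
    rfl
  exists_center x hx hcomm := by
    rw [inPeirceCorner_e₁_e₁] at hx
    have hxa : x.a ∈ Set.center A := by
      rw [Semigroup.mem_center_iff]
      intro a
      have h := congrArg GenMatrix.a (hcomm ⟨a, 0, 0, 0⟩ (inPeirceCorner_e₁_e₁.2 rfl))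
      simpa using h.symm
    obtain ⟨z, hz, hza⟩ := hA hxa
    refine ⟨z, hz, ?_⟩
    -- Commuting with `e₁` makes the `m`-entry of `z` zero, so `e₁ * z` has only its `a`-entry.
    have h := congrArg GenMatrix.m (Semigroup.mem_center_iff.1 hz e₁)
    rw [hx, ← hza]
    ext <;> simp [e₁] at h ⊢
    exact h
  domain x y hx hy hxy := by
    rw [inPeirceCorner_e₁_e₁] at hx hy
    have h : x.a * y.a = 0 := by
      rw [hx, hy] at hxy
      simpa using congrArg GenMatrix.a hxy
    refine (mul_eq_zero.1 h).imp (fun h => ?_) fun h => ?_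
    · rw [hx, h]
      rfl
    · rw [hy, h]
      rfl

theorem isGoodCorner_e₂ (hN : IsTwoTorsionFree N) (hfaithful : C.IsWeaklyFaithful)
    (hB : Set.center B ⊆ MoritaContext.GenMatrix.b '' Set.center C.GenMatrix)
    (hdomB : NoZeroDivisors B) : IsGoodCorner (e₂ : C.GenMatrix) e₁ where
  two_torsion_free x hx hxx := by
    rw [inPeirceCorner_e₂_e₁] at hx
    have h := hN x.n (by simpa [two_nsmul] using congrArg GenMatrix.n hxx)
    rw [hx, h]
    rfl
  faithful x hx hm hn := by
    rw [inPeirceCorner_e₂_e₂] at hx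
    have h := hfaithful.2 x.b
      (fun m => by
        simpa using congrArg GenMatrix.m (hn ⟨0, m, 0, 0⟩ (inPeirceCorner_e₁_e₂.2 rfl)))
      (fun n => by
        simpa using congrArg GenMatrix.n (hm ⟨0, 0, n, 0⟩ (inPeirceCorner_e₂_e₁.2 rfl)))
    rw [hx, h]
    rfl
  exists_center x hx hcomm := by
    rw [inPeirceCorner_e₂_e₂] at hx
    have hxb : x.b ∈ Set.center B := by
      rw [Semigroup.mem_center_iff]
      intro b
      have h := congrArg GenMatrix.b (hcomm ⟨0, 0, 0, b⟩ (inPeirceCorner_e₂_e₂.2 rfl))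
      simpa using h.symm
    obtain ⟨z, hz, hzb⟩ := hB hxb
    refine ⟨z, hz, ?_⟩
    have h := congrArg GenMatrix.n (Semigroup.mem_center_iff.1 hz e₂)
    rw [hx, ← hzb]
    ext <;> simp [e₂] at h ⊢
    exact h
  domain x y hx hy hxy := by
    rw [inPeirceCorner_e₂_e₂] at hx hy
    have h : x.b * y.b = 0 := by
      rw [hx, hy] at hxy
      simpa using congrArg GenMatrix.b hxy
    refine (mul_eq_zero.1 h).imp (fun h => ?_) fun h => ?_
    · rw [hx, h]
      rfl
    · rw [hy, h]
      rfl

end MoritaContext.GenMatrix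

theorem mainTheorem7 {R A B M N : Type*} [CommRing R] [Ring A] [Ring B] [Algebra R A]
    [Algebra R B] [AddCommGroup M] [AddCommGroup N]
    [Module R M] [Module A M] [Module Bᵐᵒᵖ M] [SMulCommClass A Bᵐᵒᵖ M]
    [IsScalarTower R A M] [IsScalarTower R Bᵐᵒᵖ M]
    [Module R N] [Module B N] [Module Aᵐᵒᵖ N] [SMulCommClass B Aᵐᵒᵖ N]
    [IsScalarTower R B N] [IsScalarTower R Aᵐᵒᵖ N]
    (C : MoritaContext R A B M N)
    (hMN : Nontrivial M ∨ Nontrivial N)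
    (hM : IsTwoTorsionFree M) (hN : IsTwoTorsionFree N)
    (hfaithful : C.IsWeaklyFaithful)
    (hA : MoritaContext.GenMatrix.a '' Set.center C.GenMatrix = Set.center A)
    (hB : MoritaContext.GenMatrix.b '' Set.center C.GenMatrix = Set.center B)
    (hdomA : NoZeroDivisors A) (hdomB : NoZeroDivisors B) :
    HasLHDProperty R C.GenMatrix := by
  exact IsGoodPair.hasLHDProperty ⟨MoritaContext.GenMatrix.isComplementary,
    MoritaContext.GenMatrix.isGoodCorner_e₁ hM hfaithful hA.ge hdomA,
    MoritaContext.GenMatrix.isGoodCorner_e₂ hN hfaithful hB.ge hdomB⟩
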